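/- Let $a\in\mathbb R$ with $a^2=2\pi$ (the case $L=1$ of $a^2=2\pi L$). On $\mathcal H=L^2(\mathbb R)$ let $T_1=e^{ia\hat q}$, $T_2=e^{-ia\hat p}$ be the commuting unitaries $(T_1f)(x)=e^{iax}f(x)$, $(T_2f)(x)=f(x-a)$, let $\varphi_{0}(x)=\pi^{-1/4}e^{-x^2/2}$ be the normalized vacuum, and for $n=(n_1,n_2)\in\mathbb Z^2$ let $\varphi_n=T_1^{n_1}T_2^{n_2}\varphi_0$ be the coherent states. A family is called complete if its closed linear span is $\mathcal H$. Then: 1. The coherent states $\{\varphi_n\}_{n\in\mathbb Z^2}$ are not orthonormal. 2. The orthonormalization procedure cannot produce a complete orthonormal set: there are no coefficients $(c_k)_{k\in\mathbb Z^2}\subset\mathbb C$ such that for all $n$ the series $\Psi_n=\sum_{k\in\mathbb Z^2}c_k\,\varphi_{k+n}$ converges unconditionally in norm and $\{\Psi_n\}_{n\in\mathbb Z^2}$ is a complete orthonormal set. 3. Likewise, there is no bounded operator $X$ on $\mathcal H$ (in particular no bounded $X_1=\sum_{k}c_kT_1^{k_1}T_2^{k_2}$, in whatever sense the series converges) such that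 $\{X\varphi_n\}_{n\in\mathbb Z^2}$ is a complete orthonormal set. 4. (The reductio form.) Let $X_1=\sum_{k\in\mathbb Z^2}c_kT_1^{k_1}T_2^{k_2}$ be a bounded operator, the series converging unconditionally in the strong operator topology, with $c_{-k}=\overline{c_k}$. If $\Psi_n=X_1\varphi_n$, $n\in\mathbb Z^2$, were orthonormal, with frame operator $S=\sum_n\Psi_n\langle\Psi_n,\cdot\rangle$ (unconditional strong convergence), then $S=X_1^2$; if moreover $\{\Psi_n\}$ were complete, then $S=1$; and $S=1$ would force $\{\varphi_n\}$ to be orthonormal, contrary to 1. -/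

import Mathlib

open MeasureTheory Complex

noncomputable section

namespace Coherent

/-- The Hilbert space `L²(ℝ)` of complex square integrable functions: the position representation
of a particle on the line, with position `q = x` and momentum `p = -i d/dx`. -/
abbrev StateSpace : Type := Lp ℂ 2 (volume : Measure ℝ)

theorem memLp_phase_mul (s : ℝ) (f : StateSpace) :
    MemLp (fun x : ℝ => Complex.exp (I * ((s * x : ℝ) : ℂ)) * f x) 2 volume := by
  refine (Lp.memLp f).of_le ?_ (Filter.Eventually.of_forall fun x => ?_)
  · exact (Continuous.aestronglyMeasurable (by fun_prop)).mul (Lp.aestronglyMeasurable f)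
  · rw [norm_mul, mul_comm I, Complex.norm_exp_ofReal_mul_I, one_mul]

/-- Multiplication by the phase `x ↦ exp (i s x)`. -/
def phaseFun (s : ℝ) (f : StateSpace) : StateSpace := (memLp_phase_mul s f).toLp _

theorem coeFn_phaseFun (s : ℝ) (f : StateSpace) :
    phaseFun s f =ᵐ[volume] fun x : ℝ => Complex.exp (I * ((s * x : ℝ) : ℂ)) * f x :=
  MemLp.coeFn_toLp _

theorem phaseFun_phaseFun (s t : ℝ) (h : s + t = 0) (f : StateSpace) :
    phaseFun s (phaseFun t f) = f := by
  apply Lp.ext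
  filter_upwards [coeFn_phaseFun s (phaseFun t f), coeFn_phaseFun t f] with x h1 h2
  rw [h1, h2, ← mul_assoc, ← Complex.exp_add, ← mul_add, ← Complex.ofReal_add, ← add_mul, h]
  simp

/-- The unitary operator `exp (i s q)`: `(exp (i s q) f)(x) = exp (i s x) f(x)`. -/
def expPosition (s : ℝ) : StateSpace ≃ₗᵢ[ℂ] StateSpace where
  toFun := phaseFun s
  invFun := phaseFun (-s)
  left_inv := phaseFun_phaseFun _ _ (by ring)
  right_inv := phaseFun_phaseFun _ _ (by ring)
  map_add' f g := by
    apply Lp.ext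
    filter_upwards [coeFn_phaseFun s (f + g), coeFn_phaseFun s f, coeFn_phaseFun s g,
      Lp.coeFn_add f g, Lp.coeFn_add (phaseFun s f) (phaseFun s g)] with x h1 h2 h3 h4 h5
    rw [h1, h4, h5, Pi.add_apply, Pi.add_apply, h2, h3, mul_add]
  map_smul' r f := by
    apply Lp.ext
    filter_upwards [coeFn_phaseFun s (r • f), coeFn_phaseFun s f,
      Lp.coeFn_smul r f, Lp.coeFn_smul r (phaseFun s f)] with x h1 h2 h3 h4
    rw [h1, h3, RingHom.id_apply, h4, Pi.smul_apply, Pi.smul_apply, h2, smul_eq_mul, smul_eq_mul]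
    ring
  norm_map' f := by
    change ‖phaseFun s f‖ = ‖f‖
    apply le_antisymm
    all_goals
      apply Lp.norm_le_norm_of_ae_le
      filter_upwards [coeFn_phaseFun s f] with x h1
      rw [h1, norm_mul, mul_comm I, Complex.norm_exp_ofReal_mul_I, one_mul]

theorem shift_shift (s t : ℝ) (h : s + t = 0) (f : StateSpace) :
    Lp.compMeasurePreserving (fun x : ℝ => x - s) (measurePreserving_sub_right volume s)
      (Lp.compMeasurePreserving (fun x : ℝ => x - t) (measurePreserving_sub_right volume t) f)
      = f := by
  apply Lp.ext
  have h1 := Lp.coeFn_compMeasurePreserving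
    (Lp.compMeasurePreserving (fun x : ℝ => x - t) (measurePreserving_sub_right volume t) f)
    (measurePreserving_sub_right volume s)
  have h2 := (measurePreserving_sub_right volume s).quasiMeasurePreserving.ae_eq_comp
    (Lp.coeFn_compMeasurePreserving f (measurePreserving_sub_right volume t))
  filter_upwards [h1, h2] with x e1 e2
  rw [e1, e2]
  simp only [Function.comp_apply]
  congr 1
  linarith

/-- The unitary operator `exp (-i s p)`: `(exp (-i s p) f)(x) = f(x - s)`. -/
def expMomentum (s : ℝ) : StateSpace ≃ₗᵢ[ℂ] StateSpace where
  toLinearEquiv := LinearEquiv.ofLinearMap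
    (Lp.compMeasurePreservingₗ ℂ (fun x : ℝ => x - s) (measurePreserving_sub_right volume s))
    (Lp.compMeasurePreservingₗ ℂ (fun x : ℝ => x - -s) (measurePreserving_sub_right volume (-s)))
    (LinearMap.ext fun f => shift_shift s (-s) (by ring) f)
    (LinearMap.ext fun f => shift_shift (-s) s (by ring) f)
  norm_map' f := Lp.norm_compMeasurePreserving f (measurePreserving_sub_right volume s)

/-- The operator `T₁^{n₁} T₂^{n₂}`, where `T₁ = exp (i a q)` and `T₂ = exp (-i a p)`. -/
def latticeOp (a : ℝ) (n : ℤ × ℤ) : StateSpace ≃ₗᵢ[ℂ] StateSpace :=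
  expPosition a ^ n.1 * expMomentum a ^ n.2

/-- The normalized vacuum wave function `x ↦ π^{-1/4} exp (-x²/2)`. -/
def vacuumFun (x : ℝ) : ℝ := Real.pi ^ (-(1 / 4) : ℝ) * Real.exp (-x ^ 2 / 2)

theorem memLp_vacuum : MemLp (fun x : ℝ => (vacuumFun x : ℂ)) 2 volume := by
  have hc : Continuous vacuumFun := by unfold vacuumFun; fun_prop
  suffices h : MemLp vacuumFun 2 volume from h.ofReal
  rw [memLp_two_iff_integrable_sq hc.aestronglyMeasurable]
  have h := (integrable_exp_neg_mul_sq (b := 1) one_pos).const_mul ((Real.pi ^ (-(1 / 4) : ℝ)) ^ 2)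
  refine h.congr (Filter.Eventually.of_forall fun x => ?_)
  simp only [vacuumFun, mul_pow, ← Real.exp_nat_mul]
  congr 2
  push_cast
  ring

/-- The vacuum `φ_0` of `b = (q + i p)/√2 = (x + d/dx)/√2`. -/
def vacuum : StateSpace := memLp_vacuum.toLp _

/-- The coherent state `φ_n = T₁^{n₁} T₂^{n₂} φ_0`. For `a² = 2πL` this is `φ_n^{(L)}`. -/
def coherent (a : ℝ) (n : ℤ × ℤ) : StateSpace := latticeOp a n vacuum

/-- A family of vectors is complete when its closed linear span is the whole space. -/
def CompleteFamily (Ψ : ℤ × ℤ → StateSpace) : Prop :=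
  (Submodule.span ℂ (Set.range Ψ)).topologicalClosure = ⊤

/-- `Ψ_n = ∑_k c_k φ_{k+n}` for all `n`, with unconditional convergence in norm. -/
def IsExpansion (a : ℝ) (c : ℤ × ℤ → ℂ) (Ψ : ℤ × ℤ → StateSpace) : Prop :=
  ∀ n, HasSum (fun k => c k • coherent a (k + n)) (Ψ n)

/-- `X = ∑_k c_k T₁^{k₁} T₂^{k₂}`, with unconditional convergence in the strong operator
topology. -/
def IsOperatorSeries (a : ℝ) (c : ℤ × ℤ → ℂ) (X : StateSpace →L[ℂ] StateSpace) : Prop :=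
  ∀ f, HasSum (fun k => c k • latticeOp a k f) (X f)

/-- `S = ∑_n Ψ_n ⟨Ψ_n, ·⟩`. -/
def IsFrameOperator (Ψ : ℤ × ℤ → StateSpace) (S : StateSpace →L[ℂ] StateSpace) : Prop :=
  ∀ f, HasSum (fun n => inner ℂ (Ψ n) f • Ψ n) (S f)

end Coherent

end

open Coherent

/-! The overlaps of the coherent states depend only on `n - m`, so their Gram matrix is a Toeplitz
matrix with a nonnegative symbol on the torus. Poisson summation shows that the symbol vanishes at
the point where both characters equal `-1`; twisting by `(-1)^(n₁+n₂)` moves this zero to the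
origin, and Gaussian decay makes the symbol `O(|θ|²)` there. Orthonormalizing with coefficients `c`
would force `|ĉ|²` to be the reciprocal of the symbol, which is not integrable in dimension two.

The argument is carried out without Fourier analysis. Let `e` be the hypothetical orthonormal
family, `T` the linear map `e_n ↦ φ_n` (twisted) on its algebraic span, and `Q` the `squareMean`.
The bound on the symbol (`IsCriticalGram.norm_constr_sq_le`) and a telescoping energy estimate
(`sum_norm_sub_sq_le`) give `∑_j ‖T Q^j F‖² ≤ C ‖F‖²`, while `∑_j ‖Q^j e_0‖²` diverges like the
harmonic series. A bounded `X` with `X T = id` contradicts this at once. For an expansion, Orlicz's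
theorem makes `c` square summable, and the contradiction comes from `F = ∑ c_k e_k` over finite
sets, whose images `T Q^j F` tend to `Q^j e_0`. -/

namespace Coherent

open Module Filter Topology

/-! ### Lattice translations and the averaging operator -/

section Shift

variable {E : Type*} [NormedAddCommGroup E] [InnerProductSpace ℂ E]
  {e : Basis (ℤ × ℤ) ℂ E}

/-- The translation `e_n ↦ e_{n+k}` of an orthonormal family indexed by the lattice. -/
noncomputable def shift (he : Orthonormal ℂ e) (k : ℤ × ℤ) : E ≃ₗᵢ[ℂ] E :=
  he.equiv he (Equiv.addRight k)

theorem shift_basis (he : Orthonormal ℂ e) (k n : ℤ × ℤ) : shift he k (e n) = e (n + k) :=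
  he.equiv_apply he _ n

theorem shift_shift_apply (he : Orthonormal ℂ e) (k l : ℤ × ℤ) (F : E) :
    shift he k (shift he l F) = shift he (k + l) F := by
  have h : (shift he k).toLinearEquiv.toLinearMap ∘ₗ (shift he l).toLinearEquiv.toLinearMap =
      (shift he (k + l)).toLinearEquiv.toLinearMap := by
    refine e.ext fun n => ?_
    change shift he k (shift he l (e n)) = shift he (k + l) (e n)
    rw [shift_basis, shift_basis, shift_basis, add_assoc, add_comm l k]
  exact LinearMap.congr_fun h F

theorem shift_zero_apply (he : Orthonormal ℂ e) (F : E) : shift he 0 F = F := by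
  apply (shift he 0).injective
  rw [shift_shift_apply, add_zero]

theorem norm_shift_zsmul_sub_le (he : Orthonormal ℂ e) (v : ℤ × ℤ) (F : E) (k : ℤ) :
    ‖shift he (k • v) F - F‖ ≤ |(k : ℝ)| * ‖shift he v F - F‖ := by
  have hnat : ∀ j : ℕ, ‖shift he (j • v) F - F‖ ≤ j * ‖shift he v F - F‖ := by
    intro j
    induction j with
    | zero => simp [shift_zero_apply]
    | succ j ih =>
      have h : shift he ((j + 1) • v) F - F =
          shift he (j • v) (shift he v F - F) + (shift he (j • v) F - F) := by
        rw [map_sub, shift_shift_apply, succ_nsmul]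
        abel
      rw [h]
      refine (norm_add_le _ _).trans ?_
      rw [LinearIsometryEquiv.norm_map]
      push_cast
      linarith
  rcases Int.eq_nat_or_neg k with ⟨j, rfl | rfl⟩
  · simpa using hnat j
  · have h : ‖shift he (-(j • v)) F - F‖ = ‖shift he (j • v) F - F‖ := by
      rw [← LinearIsometryEquiv.norm_map (shift he (j • v)), map_sub, shift_shift_apply,
        add_neg_cancel, shift_zero_apply, norm_sub_rev]
    rw [neg_smul, natCast_zsmul, h]
    simpa using hnat j

/-- Walk from the origin to `k` along the axes, paying one unit difference per step, and apply
Cauchy-Schwarz. -/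
theorem norm_shift_sub_sq_le (he : Orthonormal ℂ e) (F : E) (k : ℤ × ℤ) :
    ‖shift he k F - F‖ ^ 2 ≤ ((k.1 : ℝ) ^ 2 + (k.2 : ℝ) ^ 2) *
      (‖shift he (1, 0) F - F‖ ^ 2 + ‖shift he (0, 1) F - F‖ ^ 2) := by
  have hk : k = k.1 • ((1, 0) : ℤ × ℤ) + k.2 • ((0, 1) : ℤ × ℤ) := by ext <;> simp
  have h : shift he k F - F =
      shift he (k.1 • ((1, 0) : ℤ × ℤ)) (shift he (k.2 • ((0, 1) : ℤ × ℤ)) F - F) +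
        (shift he (k.1 • ((1, 0) : ℤ × ℤ)) F - F) := by
    rw [map_sub, shift_shift_apply, ← hk]
    abel
  have h1 := norm_shift_zsmul_sub_le he (1, 0) F k.1
  have h2 := norm_shift_zsmul_sub_le he (0, 1) F k.2
  have h3 : ‖shift he k F - F‖ ≤ |(k.2 : ℝ)| * ‖shift he (0, 1) F - F‖ +
      |(k.1 : ℝ)| * ‖shift he (1, 0) F - F‖ := by
    rw [h]
    refine (norm_add_le _ _).trans ?_
    rw [LinearIsometryEquiv.norm_map]
    exact add_le_add h2 h1
  refine (pow_le_pow_left₀ (norm_nonneg _) h3 2).trans ?_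
  rw [← sq_abs (k.1 : ℝ), ← sq_abs (k.2 : ℝ)]
  nlinarith [sq_nonneg (|(k.1 : ℝ)| * ‖shift he (0, 1) F - F‖ -
    |(k.2 : ℝ)| * ‖shift he (1, 0) F - F‖)]

/-- The mean of the translations along the vertices of the unit square. -/
noncomputable def squareMean (he : Orthonormal ℂ e) (F : E) : E :=
  (1 / 4 : ℂ) • (F + shift he (1, 0) F + (shift he (0, 1) F + shift he (1, 1) F))

/-- The norm lost under averaging controls the gradient. The average is at most `‖F + shift v F‖ /
2` in norm, for either axis `v`, and the parallelogram law turns this deficit into `‖shift v F -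
F‖²`. -/
theorem norm_sub_sq_add_norm_sub_sq_le (he : Orthonormal ℂ e) (F : E) :
    ‖shift he (1, 0) F - F‖ ^ 2 + ‖shift he (0, 1) F - F‖ ^ 2 ≤
      8 * (‖F‖ ^ 2 - ‖squareMean he F‖ ^ 2) := by
  have key : ∀ v w : ℤ × ℤ, v + w = (1, 1) →
      squareMean he F = (1 / 4 : ℂ) • (F + shift he v F + (shift he w F + shift he (1, 1) F)) →
      ‖shift he v F - F‖ ^ 2 ≤ 4 * (‖F‖ ^ 2 - ‖squareMean he F‖ ^ 2) := by
    intro v w hvw h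
    have hQ : ‖squareMean he F‖ ≤ ‖F + shift he v F‖ / 2 := by
      have h' : shift he w F + shift he (1, 1) F = shift he w (F + shift he v F) := by
        rw [map_add, shift_shift_apply, add_comm w v, hvw]
      rw [h, norm_smul, h']
      have := norm_add_le (F + shift he v F) (shift he w (F + shift he v F))
      rw [LinearIsometryEquiv.norm_map] at this
      rw [norm_div, norm_one, RCLike.norm_ofNat]
      linarith
    have hp := parallelogram_law_with_norm ℂ F (shift he v F)
    rw [LinearIsometryEquiv.norm_map, norm_sub_rev F] at hp
    have := pow_le_pow_left₀ (norm_nonneg _) hQ 2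
    nlinarith
  have h1 := key (1, 0) (0, 1) rfl rfl
  have h2 := key (0, 1) (1, 0) rfl (by rw [squareMean]; congr 1; abel)
  linarith

/-- The norm losses of successive averages telescope. -/
theorem sum_norm_sub_sq_le (he : Orthonormal ℂ e) (F : E) (N : ℕ) :
    ∑ j ∈ Finset.range N, (‖shift he (1, 0) ((squareMean he)^[j] F) - (squareMean he)^[j] F‖ ^ 2 +
      ‖shift he (0, 1) ((squareMean he)^[j] F) - (squareMean he)^[j] F‖ ^ 2) ≤ 8 * ‖F‖ ^ 2 := by
  suffices h : ∑ j ∈ Finset.range N,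
      (‖shift he (1, 0) ((squareMean he)^[j] F) - (squareMean he)^[j] F‖ ^ 2 +
      ‖shift he (0, 1) ((squareMean he)^[j] F) - (squareMean he)^[j] F‖ ^ 2) ≤
      8 * (‖F‖ ^ 2 - ‖(squareMean he)^[N] F‖ ^ 2) by
    nlinarith [sq_nonneg ‖(squareMean he)^[N] F‖]
  induction N with
  | zero => simp
  | succ N ih =>
    rw [Finset.sum_range_succ, Function.iterate_succ_apply']
    linarith [norm_sub_sq_add_norm_sub_sq_le he ((squareMean he)^[N] F)]

/-- The average factors as a product of commuting one-dimensional averages, to which the binomial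
theorem applies separately. -/
theorem squareMean_iterate (he : Orthonormal ℂ e) (j : ℕ) (n : ℤ × ℤ) :
    (squareMean he)^[j] (e n) = ∑ p ∈ Finset.range (j + 1) ×ˢ Finset.range (j + 1),
      ((1 / 4 : ℂ) ^ j * (j.choose p.1 * j.choose p.2)) • e (n + ((p.1 : ℤ), (p.2 : ℤ))) := by
  set S : ℤ × ℤ → Module.End ℂ E := fun k => (shift he k).toLinearEquiv.toLinearMap with hS
  have hSmul : ∀ k l, S k * S l = S (k + l) := fun k l =>
    LinearMap.ext fun F => shift_shift_apply he k l F
  have hSpow : ∀ k (i : ℕ), S k ^ i = S (i • k) := by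
    intro k i
    induction i with
    | zero => exact LinearMap.ext fun F => by rw [zero_smul]; exact (shift_zero_apply he F).symm
    | succ i ih => rw [pow_succ, ih, hSmul, succ_nsmul]
  have hQ : ∀ i F, (squareMean he)^[i] F =
      (((1 / 4 : ℂ) • ((S (1, 0) + 1) * (S (0, 1) + 1))) ^ i) F := by
    intro i F
    induction i with
    | zero => rfl
    | succ i ih =>
      rw [Function.iterate_succ_apply', ih, pow_succ', Module.End.mul_apply, squareMean,
        LinearMap.smul_apply, add_mul, mul_add, hSmul, one_mul, mul_one]
      congr 1
      simp only [LinearMap.add_apply, Module.End.one_apply]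
      simp only [hS, LinearEquiv.coe_coe, LinearIsometryEquiv.coe_toLinearEquiv, Prod.mk_add_mk,
        zero_add, add_zero]
      abel
  have hcomm : Commute (S (1, 0) + 1) (S (0, 1) + 1) := by
    refine Commute.add_left (Commute.add_right ?_ (Commute.one_right _)) (Commute.one_left _)
    change _ * _ = _ * _
    rw [hSmul, hSmul, add_comm]
  rw [hQ, smul_pow, hcomm.mul_pow, (Commute.one_right (S (1, 0))).add_pow,
    (Commute.one_right (S (0, 1))).add_pow, Finset.sum_mul_sum, ← Finset.sum_product',
    LinearMap.smul_apply, LinearMap.sum_apply, Finset.smul_sum]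
  refine Finset.sum_congr rfl fun p _ => ?_
  rw [one_pow, one_pow, mul_one, mul_one, ← nsmul_eq_mul', ← nsmul_eq_mul', smul_mul_smul_comm,
    hSpow, hSpow, hSmul, ← Nat.cast_smul_eq_nsmul ℂ, LinearMap.smul_apply, smul_smul]
  congr 1
  · push_cast; ring
  · change shift he _ (e n) = _
    rw [shift_basis]
    congr 2
    ext <;> simp

theorem norm_squareMean_iterate_sq (he : Orthonormal ℂ e) (j : ℕ) (n : ℤ × ℤ) :
    ‖(squareMean he)^[j] (e n)‖ ^ 2 = ((j.centralBinom : ℝ) / 4 ^ j) ^ 2 := by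
  have hinj : Function.Injective fun p : ℕ × ℕ => n + ((p.1 : ℤ), (p.2 : ℤ)) := by
    intro p q h
    have := add_left_cancel h
    simp only [Prod.mk.injEq, Nat.cast_inj] at this
    exact Prod.ext this.1 this.2
  have h := (he.comp _ hinj).inner_sum
    (fun p : ℕ × ℕ => (1 / 4 : ℂ) ^ j * (j.choose p.1 * j.choose p.2))
    (fun p : ℕ × ℕ => (1 / 4 : ℂ) ^ j * (j.choose p.1 * j.choose p.2))
    (Finset.range (j + 1) ×ˢ Finset.range (j + 1))
  simp only [Function.comp_apply] at h
  rw [← squareMean_iterate he j n, inner_self_eq_norm_sq_to_K] at h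
  have hcb := Nat.sum_range_choose_sq j
  rw [← Nat.centralBinom_eq_two_mul_choose] at hcb
  rw [← Complex.ofReal_inj]
  push_cast
  refine Eq.trans (by simp) (h.trans ?_)
  rw [← hcb, Finset.sum_product]
  push_cast
  simp only [map_mul, map_pow, map_div₀, map_one, map_ofNat, map_natCast]
  rw [div_pow (∑ i ∈ Finset.range (j + 1), (j.choose i : ℂ) ^ 2),
    sq (∑ i ∈ Finset.range (j + 1), (j.choose i : ℂ) ^ 2),
    Finset.sum_mul_sum, Finset.sum_div]
  refine Finset.sum_congr rfl fun i _ => ?_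
  rw [Finset.sum_div]
  refine Finset.sum_congr rfl fun l _ => ?_
  rw [one_div, inv_pow]
  field_simp

/-- There is equality at `j = 1`, and the induction step reduces to `(2j+1)² ≥ 4j(j+1)`. -/
theorem one_le_four_mul_centralBinom_sq (j : ℕ) (hj : 1 ≤ j) :
    1 / (4 * j : ℝ) ≤ ((j.centralBinom : ℝ) / 4 ^ j) ^ 2 := by
  induction j, hj using Nat.le_induction with
  | base => norm_num [Nat.centralBinom, Nat.choose]
  | succ j hj ih =>
    have hj' : (0 : ℝ) < j := by exact_mod_cast hj
    have h : ((j : ℝ) + 1) * ((j + 1).centralBinom : ℝ) = 2 * (2 * j + 1) * j.centralBinom := by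
      exact_mod_cast Nat.succ_mul_centralBinom_succ j
    have h2 : ((j + 1).centralBinom : ℝ) / 4 ^ (j + 1) =
        (2 * j + 1) / (2 * (j + 1)) * (j.centralBinom / 4 ^ j) := by
      rw [pow_succ]
      field_simp
      linarith
    rw [h2, mul_pow]
    calc 1 / (4 * ((j + 1 : ℕ) : ℝ)) = j / (j + 1) * (1 / (4 * j)) := by
          push_cast; field_simp
      _ ≤ ((2 * j + 1) / (2 * (j + 1))) ^ 2 * (1 / (4 * j)) := by
          gcongr
          rw [div_pow, div_le_div_iff₀ (by positivity) (by positivity)]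
          nlinarith
      _ ≤ _ := by gcongr

/-- Recurrence of the planar random walk. -/
theorem exists_lt_sum_norm_squareMean_iterate_sq (he : Orthonormal ℂ e) (n : ℤ × ℤ) (K : ℝ) :
    ∃ N, K < ∑ j ∈ Finset.range N, ‖(squareMean he)^[j] (e n)‖ ^ 2 := by
  by_contra! hK
  refine Real.not_summable_one_div_natCast ?_
  have hs : Summable fun j => ‖(squareMean he)^[j] (e n)‖ ^ 2 :=
    summable_of_sum_range_le (fun _ => sq_nonneg _) hK
  refine Summable.of_nonneg_of_le (fun _ => by positivity) (fun j => ?_) (hs.mul_left 4)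
  rw [norm_squareMean_iterate_sq]
  rcases Nat.eq_zero_or_pos j with rfl | hj
  · norm_num
  · have := one_le_four_mul_centralBinom_sq j hj
    rw [← div_div, div_right_comm, div_le_iff₀ (by norm_num)] at this
    linarith

end Shift

/-- A lattice-indexed family of unit vectors whose Gram matrix is a Toeplitz matrix with real
coefficients `γ` of finite second moment and of vanishing total sum. -/
structure IsCriticalGram {H : Type*} [NormedAddCommGroup H] [InnerProductSpace ℂ H]
    (φ : ℤ × ℤ → H) (γ : ℤ × ℤ → ℝ) : Prop where
  inner_eq : ∀ m n, inner ℂ (φ m) (φ n) = γ (n - m)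
  zero : γ 0 = 1
  hasSum : HasSum γ 0
  summable_moment : Summable fun k : ℤ × ℤ => |γ k| * ((k.1 : ℝ) ^ 2 + (k.2 : ℝ) ^ 2)

/-! ### Critical Gram matrices and bounded operators -/

section Gram

variable {H : Type*} [NormedAddCommGroup H] [InnerProductSpace ℂ H]
  {E : Type*} [NormedAddCommGroup E] [InnerProductSpace ℂ E] {e : Basis (ℤ × ℤ) ℂ E}
  {φ : ℤ × ℤ → H} {γ : ℤ × ℤ → ℝ}

theorem IsCriticalGram.norm_eq_one (hφ : IsCriticalGram φ γ) (k : ℤ × ℤ) : ‖φ k‖ = 1 := by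
  rw [← pow_eq_one_iff_of_nonneg (norm_nonneg _) two_ne_zero, ← inner_self_eq_norm_sq (𝕜 := ℂ),
    hφ.inner_eq, sub_self, hφ.zero]
  simp

/-- Both sides are sesquilinear, so basis vectors suffice; there only the term `k = n - m` survives.
-/
theorem IsCriticalGram.hasSum_inner_shift (hφ : IsCriticalGram φ γ) (he : Orthonormal ℂ e)
    (F G : E) : HasSum (fun k => (γ k : ℂ) * inner ℂ (shift he k F) G)
      (inner ℂ (e.constr ℂ φ F) (e.constr ℂ φ G)) := by
  have hF : F ∈ Submodule.span ℂ (Set.range e) := e.mem_span F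
  have hG : G ∈ Submodule.span ℂ (Set.range e) := e.mem_span G
  induction hF using Submodule.span_induction with
  | mem F h =>
    obtain ⟨m, rfl⟩ := h
    induction hG using Submodule.span_induction with
    | mem G h =>
      obtain ⟨n, rfl⟩ := h
      rw [Basis.constr_basis, Basis.constr_basis, hφ.inner_eq]
      convert hasSum_single (n - m) ?_ using 1
      · rw [shift_basis, add_sub_cancel, inner_self_eq_norm_sq_to_K, he.1]
        simp
      · intro k hk
        rw [shift_basis, he.2, mul_zero]
        rintro rfl
        exact hk (by abel)
    | zero => simp [hasSum_zero]
    | add G G' _ _ h h' => simpa only [map_add, inner_add_right, mul_add] using h.add h'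
    | smul c G _ h =>
      simpa only [map_smul, inner_smul_right, mul_left_comm] using h.mul_left c
  | zero => simp [hasSum_zero]
  | add F F' _ _ h h' => simpa only [map_add, inner_add_left, mul_add] using h.add h'
  | smul c F _ h =>
    simpa only [map_smul, inner_smul_left, mul_left_comm] using h.mul_left (starRingEnd ℂ c)

/-- Because its coefficients sum to zero, the Gram form is dominated by the lattice Laplacian. -/
theorem IsCriticalGram.norm_constr_sq_le (hφ : IsCriticalGram φ γ) (he : Orthonormal ℂ e) (F : E) :
    ‖e.constr ℂ φ F‖ ^ 2 ≤ (∑' k : ℤ × ℤ, |γ k| * ((k.1 : ℝ) ^ 2 + (k.2 : ℝ) ^ 2)) *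
      (‖shift he (1, 0) F - F‖ ^ 2 + ‖shift he (0, 1) F - F‖ ^ 2) := by
  have h1 := Complex.hasSum_re (hφ.hasSum_inner_shift he F F)
  have h2 := (h1.sub (hφ.hasSum.mul_right (‖F‖ ^ 2)))
  -- Subtracting `‖F‖² ∑ γ k = 0` is free and replaces each inner product by a squared difference.
  rw [zero_mul, sub_zero] at h2
  have h3 : (inner ℂ (e.constr ℂ φ F) (e.constr ℂ φ F)).re = ‖e.constr ℂ φ F‖ ^ 2 :=
    inner_self_eq_norm_sq (𝕜 := ℂ) _
  rw [h3] at h2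
  refine hasSum_le (fun k => ?_) h2 (hφ.summable_moment.hasSum.mul_right _)
  have h4 := norm_sub_sq (𝕜 := ℂ) (shift he k F) F
  rw [LinearIsometryEquiv.norm_map, RCLike.re_eq_complex_re] at h4
  have h5 := norm_shift_sub_sq_le he F k
  have h6 : ((γ k : ℂ) * inner ℂ (shift he k F) F).re - γ k * ‖F‖ ^ 2 =
      -(γ k) * (‖shift he k F - F‖ ^ 2 / 2) := by
    rw [Complex.re_ofReal_mul, h4]
    ring
  rw [h6, mul_assoc]
  refine (mul_le_mul_of_nonneg_right (neg_le_abs (γ k)) (by positivity)).trans ?_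
  gcongr
  linarith [sq_nonneg ‖shift he k F - F‖]

theorem IsCriticalGram.exists_sum_norm_constr_sq_le (hφ : IsCriticalGram φ γ)
    (he : Orthonormal ℂ e) : ∃ C, 0 ≤ C ∧ ∀ (F : E) (N : ℕ),
      ∑ j ∈ Finset.range N, ‖e.constr ℂ φ ((squareMean he)^[j] F)‖ ^ 2 ≤ C * ‖F‖ ^ 2 := by
  have hC : 0 ≤ ∑' k : ℤ × ℤ, |γ k| * ((k.1 : ℝ) ^ 2 + (k.2 : ℝ) ^ 2) :=
    tsum_nonneg fun k => by positivity
  refine ⟨(∑' k : ℤ × ℤ, |γ k| * ((k.1 : ℝ) ^ 2 + (k.2 : ℝ) ^ 2)) * 8, by positivity,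
    fun F N => ?_⟩
  refine (Finset.sum_le_sum fun j _ => hφ.norm_constr_sq_le he _).trans ?_
  rw [← Finset.mul_sum, mul_assoc]
  exact mul_le_mul_of_nonneg_left (sum_norm_sub_sq_le he F N) hC

/-- The orthonormal Hamel basis given by an orthonormal family of its linear span. -/
noncomputable def spanBasis {Ψ : ℤ × ℤ → H} (hΨ : Orthonormal ℂ Ψ) :
    Basis (ℤ × ℤ) ℂ (Submodule.span ℂ (Set.range Ψ)) :=
  Basis.span hΨ.linearIndependent

theorem coe_spanBasis {Ψ : ℤ × ℤ → H} (hΨ : Orthonormal ℂ Ψ) (n : ℤ × ℤ) :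
    (spanBasis hΨ n : H) = Ψ n :=
  congrArg Subtype.val (Basis.span_apply hΨ.linearIndependent n)

theorem orthonormal_spanBasis {Ψ : ℤ × ℤ → H} (hΨ : Orthonormal ℂ Ψ) :
    Orthonormal ℂ (spanBasis hΨ) := by
  rw [orthonormal_iff_ite]
  intro i j
  rw [Submodule.coe_inner, coe_spanBasis, coe_spanBasis, orthonormal_iff_ite.mp hΨ]

/-- A bounded operator cannot orthonormalize a family with critical Gram matrix. -/
theorem IsCriticalGram.not_orthonormal_map {H' : Type*} [NormedAddCommGroup H']
    [InnerProductSpace ℂ H'] (hφ : IsCriticalGram φ γ) (X : H →L[ℂ] H') :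
    ¬ Orthonormal ℂ fun n => X (φ n) := by
  intro hΨ
  have he := orthonormal_spanBasis hΨ
  set e := spanBasis hΨ with he_def
  obtain ⟨C, hC, hbound⟩ := hφ.exists_sum_norm_constr_sq_le he
  -- `X` is a left inverse of `e_n ↦ φ_n`, so the latter cannot shrink vectors by more than the
  -- factor `‖X‖`.
  have hX : ∀ F, X (e.constr ℂ φ F) = F := by
    intro F
    have h : X.toLinearMap ∘ₗ e.constr ℂ φ = Submodule.subtype _ := by
      refine e.ext fun n => ?_
      rw [LinearMap.comp_apply, Basis.constr_basis, Submodule.subtype_apply, he_def,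
        coe_spanBasis]
      rfl
    exact LinearMap.congr_fun h F
  obtain ⟨N, hN⟩ := exists_lt_sum_norm_squareMean_iterate_sq he 0 (‖X‖ ^ 2 * (C * ‖e 0‖ ^ 2))
  refine hN.not_ge ?_
  refine le_trans ?_ (mul_le_mul_of_nonneg_left (hbound (e 0) N) (sq_nonneg ‖X‖))
  rw [Finset.mul_sum]
  refine Finset.sum_le_sum fun j _ => ?_
  rw [← mul_pow]
  refine pow_le_pow_left₀ (norm_nonneg _) ?_ 2
  rw [← Submodule.norm_coe, ← hX]
  exact X.le_opNorm _

end Gram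

/-! ### Unconditionally convergent expansions -/

section Unconditional

variable {ι H : Type*} [NormedAddCommGroup H] [InnerProductSpace ℂ H]

/-- Some choice of signs makes the norm of a signed sum at least the sum in quadrature. -/
theorem exists_sum_norm_sq_le_norm_sub_sq [DecidableEq ι] (x : ι → H) (s : Finset ι) :
    ∃ t ⊆ s, ∑ i ∈ s, ‖x i‖ ^ 2 ≤ ‖∑ i ∈ t, x i - ∑ i ∈ s \ t, x i‖ ^ 2 := by
  induction s using Finset.induction_on with
  | empty => exact ⟨∅, subset_rfl, by simp⟩
  | insert i s hi ih =>
    obtain ⟨t, hts, ht⟩ := ih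
    have hit : i ∉ t := fun h => hi (hts h)
    set y := ∑ i ∈ t, x i - ∑ i ∈ s \ t, x i with hy
    have hp := parallelogram_law_with_norm ℂ y (x i)
    rw [Finset.sum_insert hi]
    -- The squares of `‖y ± x i‖` average to `‖y‖² + ‖x i‖²`, so the sign giving the larger norm
    -- works.
    rcases le_total ‖y - x i‖ ‖y + x i‖ with h | h
    · refine ⟨insert i t, Finset.insert_subset_insert i hts, ?_⟩
      have hs : insert i s \ insert i t = s \ t := by
        ext j; simp only [Finset.mem_sdiff, Finset.mem_insert]
        grind
      rw [hs, Finset.sum_insert hit, add_sub_assoc, ← hy, add_comm (x i) y]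
      nlinarith [norm_nonneg (y - x i)]
    · refine ⟨t, hts.trans (Finset.subset_insert i s), ?_⟩
      rw [Finset.insert_sdiff_of_notMem _ hit, Finset.sum_insert (by simp [hi]),
        add_comm (x i), ← sub_sub, ← hy]
      nlinarith [norm_nonneg (y + x i)]

/-- Beyond a finite set `t` all finite sums have norm below `1`; the part inside `t` is bounded by
the triangle inequality. -/
theorem exists_norm_sum_le_of_hasSum {H : Type*} [NormedAddCommGroup H] {x : ι → H} {z : H}
    (hx : HasSum x z) : ∃ M, ∀ s : Finset ι, ‖∑ i ∈ s, x i‖ ≤ M := by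
  classical
  obtain ⟨t, ht⟩ := cauchySeq_finset_iff_vanishing_norm.mp hx.cauchySeq 1 one_pos
  refine ⟨1 + ∑ i ∈ t, ‖x i‖, fun s => ?_⟩
  rw [← Finset.sum_inter_add_sum_sdiff s t, add_comm]
  refine (norm_add_le _ _).trans (add_le_add (ht _ Finset.sdiff_disjoint).le ?_)
  exact (norm_sum_le _ _).trans (Finset.sum_le_sum_of_subset_of_nonneg Finset.inter_subset_right
    fun _ _ _ => norm_nonneg _)

/-- Orlicz's theorem for Hilbert spaces. -/
theorem exists_sum_norm_sq_le_of_hasSum {x : ι → H} {z : H} (hx : HasSum x z) :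
    ∃ M, ∀ s : Finset ι, ∑ i ∈ s, ‖x i‖ ^ 2 ≤ M := by
  classical
  obtain ⟨M, hM⟩ := exists_norm_sum_le_of_hasSum hx
  refine ⟨(M + M) ^ 2, fun s => ?_⟩
  obtain ⟨t, -, ht⟩ := exists_sum_norm_sq_le_norm_sub_sq x s
  refine ht.trans (pow_le_pow_left₀ (norm_nonneg _) ?_ 2)
  exact (norm_sub_le _ _).trans (add_le_add (hM _) (hM _))

/-- Unconditionally convergent lattice-covariant expansions cannot orthonormalize a family with
critical Gram matrix. -/
theorem IsCriticalGram.not_orthonormal_of_hasSum {φ Ψ : ℤ × ℤ → H} {γ : ℤ × ℤ → ℝ}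
    (hφ : IsCriticalGram φ γ) {c : ℤ × ℤ → ℂ}
    (hc : ∀ n, HasSum (fun k => c k • φ (k + n)) (Ψ n)) : ¬ Orthonormal ℂ Ψ := by
  intro hΨ
  have he := orthonormal_spanBasis hΨ
  set e := spanBasis hΨ with he_def
  obtain ⟨C, hC, hbound⟩ := hφ.exists_sum_norm_constr_sq_le he
  obtain ⟨M, hM⟩ := exists_sum_norm_sq_le_of_hasSum (hc 0)
  -- Since the `φ k` are unit vectors, Orlicz's bound says that `c` is square summable.
  have hnorm : ∀ s : Finset (ℤ × ℤ), ‖∑ k ∈ s, c k • e k‖ ^ 2 ≤ M := by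
    intro s
    refine le_trans (le_of_eq ?_) (hM s)
    have h := he.inner_sum c c s
    rw [inner_self_eq_norm_sq_to_K] at h
    rw [← Complex.ofReal_inj]
    push_cast
    refine Eq.trans (by simp) (h.trans (Finset.sum_congr rfl fun k _ => ?_))
    rw [norm_smul, hφ.norm_eq_one, mul_one, Complex.conj_mul']
  -- The translate by `n` is carried along because each further average involves translates of the
  -- previous one.
  have htendsto : ∀ (j : ℕ) (n : ℤ × ℤ), Tendsto (fun s : Finset (ℤ × ℤ) =>
      e.constr ℂ φ (shift he n ((squareMean he)^[j] (∑ k ∈ s, c k • e k)))) atTop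
      (𝓝 (shift he n ((squareMean he)^[j] (e 0)) : H)) := by
    intro j
    induction j with
    | zero =>
      intro n
      simp only [Function.iterate_zero, id_eq, map_sum, map_smul, shift_basis,
        Basis.constr_basis, zero_add]
      rw [he_def, coe_spanBasis]
      exact hc n
    | succ j ih =>
      intro n
      simp only [Function.iterate_succ_apply', squareMean, map_smul, map_add, shift_shift_apply,
        Submodule.coe_smul, Submodule.coe_add]
      exact (((ih n).add (ih _)).add ((ih _).add (ih _))).const_smul _
  obtain ⟨N, hN⟩ := exists_lt_sum_norm_squareMean_iterate_sq he 0 (C * M)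
  -- Only finitely many `j` occur, so the limit over `s` can be taken before `N` matters; the bound
  -- `C * M` is uniform in `s`.
  have hlim := tendsto_finsetSum (Finset.range N) fun j _ => ((htendsto j 0).norm.pow 2)
  simp only [shift_zero_apply, Submodule.norm_coe] at hlim
  refine hN.not_ge (le_of_tendsto hlim (Eventually.of_forall fun s => ?_))
  exact (hbound _ N).trans (mul_le_mul_of_nonneg_left (hnorm s) hC)

end Unconditional

/-! ### Vanishing of the twisted Gaussian lattice sum -/

section Gaussian

theorem summable_pow_mul_exp_neg_pi_div_two_mul_sq (m : ℕ) :
    Summable fun k : ℤ => |(k : ℝ)| ^ m * Real.exp (-Real.pi / 2 * (k : ℝ) ^ 2) := by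
  refine (summable_pow_mul_jacobiTheta₂_term_bound 0 one_half_pos m).congr fun k => ?_
  rw [mul_zero, zero_mul, sub_zero, ← mul_assoc, mul_one_div, neg_div, Int.cast_abs]

/-- The Gram coefficients of the coherent states twisted by `(-1)^{n₁+n₂}`. -/
noncomputable def twistedGram (k : ℤ × ℤ) : ℝ :=
  (-1 : ℝ) ^ (k.1 * k.2 + (k.1 + k.2)) *
    (Real.exp (-Real.pi / 2 * (k.1 : ℝ) ^ 2) * Real.exp (-Real.pi / 2 * (k.2 : ℝ) ^ 2))

theorem abs_twistedGram (k : ℤ × ℤ) : |twistedGram k| =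
    Real.exp (-Real.pi / 2 * (k.1 : ℝ) ^ 2) * Real.exp (-Real.pi / 2 * (k.2 : ℝ) ^ 2) := by
  rw [twistedGram, abs_mul, abs_zpow, abs_neg, abs_one, one_zpow, one_mul, abs_of_pos]
  positivity

/-- The sign is `+1` when both coordinates are even and `-1` otherwise, so the sum is `2U² - G²`,
with `G` the sum of `g` over all integers and `U` its sum over the even ones. Poisson summation
gives `U = G / √2`. -/
theorem hasSum_twistedGram : HasSum twistedGram 0 := by
  set g : ℤ → ℝ := fun k => Real.exp (-Real.pi / 2 * (k : ℝ) ^ 2) with hg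
  set u : ℤ → ℝ := fun k => if Even k then g k else 0 with hu
  have hgs : Summable g := by simpa using summable_pow_mul_exp_neg_pi_div_two_mul_sq 0
  have hg0 : 0 ≤ g := fun k => (Real.exp_pos _).le
  have hu0 : 0 ≤ u := fun k => by
    simp only [hu]; split_ifs
    exacts [hg0 k, le_rfl]
  have hus : Summable u := hgs.of_nonneg_of_le hu0 fun k => by
    simp only [hu]; split_ifs
    exacts [le_rfl, hg0 k]
  have huB : ∑' k, u k = ∑' k : ℤ, Real.exp (-Real.pi * 2 * (k : ℝ) ^ 2) := by
    have hinj : Function.Injective fun k : ℤ => 2 * k := mul_right_injective₀ two_ne_zero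
    rw [← hinj.tsum_eq]
    · refine tsum_congr fun k => ?_
      simp only [hu, hg, even_two_mul, if_true]
      congr 1
      push_cast
      ring
    · intro k hk
      by_cases h : Even k
      · obtain ⟨l, rfl⟩ := h
        exact ⟨l, two_mul l⟩
      · simp [hu, h] at hk
  have hpoisson : (∑' k, g k) * (∑' k, g k) = 2 * ((∑' k, u k) * ∑' k, u k) := by
    rw [huB, Real.tsum_exp_neg_mul_int_sq two_pos]
    have h2 : ((2 : ℝ) ^ (1 / 2 : ℝ)) * (2 : ℝ) ^ (1 / 2 : ℝ) = 2 := by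
      rw [← Real.rpow_add two_pos]; norm_num
    have h3 : (2 : ℝ) ^ (1 / 2 : ℝ) ≠ 0 := (Real.rpow_pos_of_pos two_pos _).ne'
    change _ = 2 * (1 / 2 ^ (1 / 2 : ℝ) * (∑' k, g k) * (1 / 2 ^ (1 / 2 : ℝ) * ∑' k, g k))
    field_simp
    rw [sq (2 ^ (1 / 2 : ℝ) : ℝ), h2]
  have h := ((hus.hasSum.mul hus.hasSum (hus.mul_of_nonneg hus hu0 hu0)).mul_left 2).sub
    (hgs.hasSum.mul hgs.hasSum (hgs.mul_of_nonneg hgs hg0 hg0))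
  rw [← hpoisson, sub_self] at h
  have hsplit : twistedGram = fun k : ℤ × ℤ => 2 * (u k.1 * u k.2) - g k.1 * g k.2 := by
    ext ⟨k, l⟩
    simp only [twistedGram, hu]
    rcases Int.even_or_odd k with hk | hk <;> rcases Int.even_or_odd l with hl | hl
    · rw [((hk.mul_right l).add (hk.add hl)).neg_one_zpow, if_pos hk, if_pos hl]
      ring
    · rw [((hk.mul_right l).add_odd (hk.add_odd hl)).neg_one_zpow,
        if_neg (Int.not_even_iff_odd.mpr hl)]
      ring
    · rw [((hl.mul_left k).add_odd (hk.add_even hl)).neg_one_zpow,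
        if_neg (Int.not_even_iff_odd.mpr hk)]
      ring
    · rw [((hk.mul hl).add_even (hk.add_odd hl)).neg_one_zpow,
        if_neg (Int.not_even_iff_odd.mpr hl)]
      ring
  rw [hsplit]
  exact h

theorem summable_twistedGram_moment :
    Summable fun k : ℤ × ℤ => |twistedGram k| * ((k.1 : ℝ) ^ 2 + (k.2 : ℝ) ^ 2) := by
  have h0 : Summable fun k : ℤ => Real.exp (-Real.pi / 2 * (k : ℝ) ^ 2) := by
    simpa using summable_pow_mul_exp_neg_pi_div_two_mul_sq 0
  have h2 : Summable fun k : ℤ => (k : ℝ) ^ 2 * Real.exp (-Real.pi / 2 * (k : ℝ) ^ 2) := by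
    simpa using summable_pow_mul_exp_neg_pi_div_two_mul_sq 2
  refine ((h2.mul_of_nonneg h0 (fun _ => by positivity) fun _ => by positivity).add
    (h0.mul_of_nonneg h2 (fun _ => by positivity) fun _ => by positivity)).congr fun k => ?_
  rw [abs_twistedGram]
  ring

end Gaussian

/-! ### The Gram matrix of the coherent states -/

section Lattice

theorem zpow_eq_of_map_add {G : Type*} [Group G] {f : ℝ → G} (hf : ∀ s t, f (s + t) = f s * f t)
    (a : ℝ) (n : ℤ) : f a ^ n = f (n * a) := by
  have h := map_zpow (MonoidHom.mk' (fun s : Multiplicative ℝ => f s.toAdd)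
    fun s t => hf s.toAdd t.toAdd) (Multiplicative.ofAdd a) n
  simpa [toAdd_zpow] using h.symm

theorem coeFn_expPosition (s : ℝ) (f : StateSpace) :
    expPosition s f =ᵐ[volume] fun x : ℝ => Complex.exp (I * ((s * x : ℝ) : ℂ)) * f x :=
  coeFn_phaseFun s f

theorem coeFn_expMomentum (s : ℝ) (f : StateSpace) :
    expMomentum s f =ᵐ[volume] fun x : ℝ => f (x - s) :=
  Lp.coeFn_compMeasurePreserving f (measurePreserving_sub_right volume s)

theorem coeFn_expMomentum_comp {f : StateSpace} {g : ℝ → ℂ} (hg : f =ᵐ[volume] g) (s : ℝ) :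
    expMomentum s f =ᵐ[volume] fun x : ℝ => g (x - s) :=
  (coeFn_expMomentum s f).trans
    ((measurePreserving_sub_right volume s).quasiMeasurePreserving.ae_eq_comp hg)

theorem expPosition_add (s t : ℝ) : expPosition (s + t) = expPosition s * expPosition t := by
  ext1 f
  apply Lp.ext
  rw [LinearIsometryEquiv.coe_mul, Function.comp_apply]
  filter_upwards [coeFn_expPosition (s + t) f, coeFn_expPosition s (expPosition t f),
    coeFn_expPosition t f] with x h1 h2 h3
  rw [h1, h2, h3, ← mul_assoc, ← Complex.exp_add]
  congr 2
  push_cast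
  ring

theorem expMomentum_add (s t : ℝ) : expMomentum (s + t) = expMomentum s * expMomentum t := by
  ext1 f
  apply Lp.ext
  rw [LinearIsometryEquiv.coe_mul, Function.comp_apply]
  filter_upwards [coeFn_expMomentum (s + t) f,
    coeFn_expMomentum_comp (coeFn_expMomentum t f) s] with x h1 h2
  rw [h1, h2, sub_sub]

theorem commute_expPosition_expMomentum {a : ℝ} (ha : a ^ 2 = 2 * Real.pi) :
    Commute (expPosition a) (expMomentum a) := by
  change _ * _ = _ * _
  ext1 f
  apply Lp.ext
  rw [LinearIsometryEquiv.coe_mul, Function.comp_apply, LinearIsometryEquiv.coe_mul,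
    Function.comp_apply]
  filter_upwards [coeFn_expPosition a (expMomentum a f), coeFn_expMomentum a f,
    coeFn_expMomentum_comp (coeFn_expPosition a f) a] with x h1 h2 h3
  rw [h1, h2, h3]
  congr 1
  -- Commuting the two operators costs the phase `exp(i a²) = exp(2πi) = 1`.
  have h : I * ((a * x : ℝ) : ℂ) = I * ((a * (x - a) : ℝ) : ℂ) + 2 * Real.pi * I := by
    have : (2 * Real.pi : ℂ) = (a : ℂ) ^ 2 := by exact_mod_cast ha.symm
    rw [this]
    push_cast
    ring
  rw [h, Complex.exp_add, Complex.exp_two_pi_mul_I, mul_one]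

theorem latticeOp_add {a : ℝ} (ha : a ^ 2 = 2 * Real.pi) (m n : ℤ × ℤ) :
    latticeOp a (m + n) = latticeOp a m * latticeOp a n := by
  simp only [latticeOp, Prod.fst_add, Prod.snd_add, zpow_add]
  exact (((commute_expPosition_expMomentum ha).zpow_zpow n.1 m.2).mul_mul_mul_comm _ _)

theorem latticeOp_zero (a : ℝ) : latticeOp a 0 = 1 := by simp [latticeOp]

theorem latticeOp_neg_apply {a : ℝ} (ha : a ^ 2 = 2 * Real.pi) (k : ℤ × ℤ) (f : StateSpace) :
    latticeOp a (-k) (latticeOp a k f) = f := by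
  have h := congrArg (fun U : StateSpace ≃ₗᵢ[ℂ] StateSpace => U f) (latticeOp_add ha (-k) k)
  rw [neg_add_cancel, latticeOp_zero] at h
  exact h.symm

theorem inner_latticeOp_right {a : ℝ} (ha : a ^ 2 = 2 * Real.pi) (k : ℤ × ℤ) (f g : StateSpace) :
    inner ℂ f (latticeOp a k g) = inner ℂ (latticeOp a (-k) f) g := by
  rw [← LinearIsometryEquiv.inner_map_map (latticeOp a (-k)), latticeOp_neg_apply ha]

theorem inner_coherent_eq {a : ℝ} (ha : a ^ 2 = 2 * Real.pi) (m n : ℤ × ℤ) :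
    inner ℂ (coherent a m) (coherent a n) = inner ℂ vacuum (coherent a (n - m)) := by
  rw [coherent, coherent, coherent, sub_eq_add_neg, add_comm, latticeOp_add ha,
    LinearIsometryEquiv.coe_mul, Function.comp_apply, inner_latticeOp_right ha (-m), neg_neg]

theorem coeFn_coherent (a : ℝ) (n : ℤ × ℤ) : coherent a n =ᵐ[volume] fun x : ℝ =>
    Complex.exp (I * ((n.1 * a * x : ℝ) : ℂ)) * (vacuumFun (x - n.2 * a) : ℂ) := by
  rw [coherent, latticeOp, zpow_eq_of_map_add expPosition_add, zpow_eq_of_map_add expMomentum_add,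
    LinearIsometryEquiv.coe_mul, Function.comp_apply]
  filter_upwards [coeFn_expPosition (n.1 * a) (expMomentum (n.2 * a) vacuum),
    coeFn_expMomentum_comp memLp_vacuum.coeFn_toLp (n.2 * a)] with x h1 h2
  rw [h1, vacuum, h2]

theorem inner_vacuum_coherent {a : ℝ} (ha : a ^ 2 = 2 * Real.pi) (n : ℤ × ℤ) :
    inner ℂ vacuum (coherent a n) = (((-1 : ℝ) ^ (n.1 * n.2) *
      (Real.exp (-Real.pi / 2 * (n.1 : ℝ) ^ 2) *
        Real.exp (-Real.pi / 2 * (n.2 : ℝ) ^ 2)) : ℝ) : ℂ) := by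
  rw [L2.inner_def]
  have hπ : ((Real.pi ^ (-(1 / 4) : ℝ) : ℝ) : ℂ) * ((Real.pi ^ (-(1 / 4) : ℝ) : ℝ) : ℂ) *
      (Real.pi / -(-1 : ℂ)) ^ (1 / 2 : ℂ) = 1 := by
    rw [neg_neg, div_one, show (1 / 2 : ℂ) = ((1 / 2 : ℝ) : ℂ) by push_cast; rfl,
      ← Complex.ofReal_cpow Real.pi_pos.le, ← Complex.ofReal_mul, ← Complex.ofReal_mul,
      ← Real.rpow_add Real.pi_pos, ← Real.rpow_add Real.pi_pos]
    norm_num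
  have hint : ∀ᵐ x : ℝ, inner ℂ ((vacuum : StateSpace) x) (coherent a n x) =
      ((Real.pi ^ (-(1 / 4) : ℝ) : ℝ) : ℂ) * ((Real.pi ^ (-(1 / 4) : ℝ) : ℝ) : ℂ) *
      cexp ((-1) * (x : ℂ) ^ 2 + (I * n.1 * a + n.2 * a) * x + (-(n.2 * a) ^ 2 / 2)) := by
    filter_upwards [memLp_vacuum.coeFn_toLp, coeFn_coherent a n] with x h1 h2
    rw [vacuum, h1, h2, RCLike.inner_apply, Complex.conj_ofReal, vacuumFun,
      vacuumFun]
    push_cast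
    rw [show ∀ u v w z : ℂ, u * (v * w) * (v * z) = v * v * (u * w * z) by intros; ring,
      ← Complex.exp_add, ← Complex.exp_add]
    congr 2
    ring
  rw [integral_congr_ae hint, integral_const_mul, integral_cexp_quadratic (by simp), ← mul_assoc,
    hπ, one_mul]
  have ha' : (a : ℂ) ^ 2 = 2 * Real.pi := by exact_mod_cast ha
  -- Completing the square leaves the cross term `i n₁ n₂ a² / 2 = iπ n₁ n₂`, the source of the sign
  -- `(-1)^(n₁ n₂)`.
  have hexp : -(n.2 * a : ℂ) ^ 2 / 2 - (I * n.1 * a + n.2 * a) ^ 2 / (4 * (-1)) =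
      ((n.1 * n.2 : ℤ) : ℂ) * (Real.pi * I) + (((-Real.pi / 2 * (n.1 : ℝ) ^ 2 : ℝ) : ℂ) +
        ((-Real.pi / 2 * (n.2 : ℝ) ^ 2 : ℝ) : ℂ)) := by
    push_cast
    linear_combination (I ^ 2 * n.1 ^ 2 / 4 + I * n.1 * n.2 / 2 - n.2 ^ 2 / 4 : ℂ) * ha' +
      (Real.pi * n.1 ^ 2 / 2 : ℂ) * Complex.I_sq
  rw [hexp, Complex.exp_add, Complex.exp_add, Complex.exp_int_mul, Complex.exp_pi_mul_I]
  push_cast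
  rfl

/-- The coherent states twisted by the character `(-1)^{n₁+n₂}`, which moves the zero of the symbol
of the Gram matrix to the origin. -/
noncomputable def twistedCoherent (a : ℝ) (n : ℤ × ℤ) : StateSpace :=
  (-1 : ℂ) ^ (n.1 + n.2) • coherent a n

theorem isCriticalGram_twistedCoherent {a : ℝ} (ha : a ^ 2 = 2 * Real.pi) :
    IsCriticalGram (twistedCoherent a) twistedGram where
  inner_eq m n := by
    rw [twistedCoherent, twistedCoherent, inner_smul_left, inner_smul_right, inner_coherent_eq ha,
      inner_vacuum_coherent ha, twistedGram, ← mul_assoc]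
    push_cast
    rw [← mul_assoc]
    congr 1
    rw [mul_comm]
    have h1 : (-1 : ℂ) ≠ 0 := neg_ne_zero.mpr one_ne_zero
    have hconj : (starRingEnd ℂ) ((-1) ^ (m.1 + m.2)) = (-1) ^ (-(m.1 + m.2)) := by
      rw [map_zpow₀, map_neg, map_one, zpow_neg, ← inv_zpow, inv_neg, inv_one]
    rw [hconj, ← zpow_add₀ h1, ← zpow_add₀ h1]
    congr 1
    simp only [Prod.fst_sub, Prod.snd_sub]
    ring
  zero := by simp [twistedGram]
  hasSum := hasSum_twistedGram
  summable_moment := summable_twistedGram_moment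

end Lattice

/-! ### Consequences for the von Neumann lattice -/

theorem not_orthonormal_coherent {a : ℝ} (ha : a ^ 2 = 2 * Real.pi) :
    ¬ Orthonormal ℂ (coherent a) := by
  intro h
  have h1 : inner ℂ (coherent a (0, 0)) (coherent a (1, 0)) = 0 := h.2 (by decide)
  rw [inner_coherent_eq ha, inner_vacuum_coherent ha, Complex.ofReal_eq_zero] at h1
  have h2 : ∀ j : ℤ, (-1 : ℝ) ^ j ≠ 0 := fun j => zpow_ne_zero j (neg_ne_zero.mpr one_ne_zero)
  exact mul_ne_zero (h2 _) (mul_pos (Real.exp_pos _) (Real.exp_pos _)).ne' h1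

theorem orthonormal_sign_smul {Ψ : ℤ × ℤ → StateSpace} (hΨ : Orthonormal ℂ Ψ) :
    Orthonormal ℂ fun n : ℤ × ℤ => (-1 : ℂ) ^ (n.1 + n.2) • Ψ n := by
  refine ⟨fun n => ?_, fun m n hmn => ?_⟩
  · rw [norm_smul, hΨ.1, norm_zpow, norm_neg, norm_one, one_zpow, one_mul]
  · simp only [inner_smul_left, inner_smul_right]
    rw [hΨ.2 hmn, mul_zero, mul_zero]

/-- No bounded operator orthonormalizes the coherent states of the von Neumann lattice. -/
theorem not_orthonormal_map_coherent {a : ℝ} (ha : a ^ 2 = 2 * Real.pi)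
    (X : StateSpace →L[ℂ] StateSpace) : ¬ Orthonormal ℂ fun n => X (coherent a n) := by
  intro h
  refine (isCriticalGram_twistedCoherent ha).not_orthonormal_map X ?_
  simpa only [twistedCoherent, map_smul] using orthonormal_sign_smul h

/-- No unconditionally convergent expansion orthonormalizes the coherent states of the von Neumann
lattice. -/
theorem not_orthonormal_of_isExpansion {a : ℝ} (ha : a ^ 2 = 2 * Real.pi) {c : ℤ × ℤ → ℂ}
    {Ψ : ℤ × ℤ → StateSpace} (hc : IsExpansion a c Ψ) : ¬ Orthonormal ℂ Ψ := by
  intro h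
  refine (isCriticalGram_twistedCoherent ha).not_orthonormal_of_hasSum
    (c := fun k => (-1 : ℂ) ^ (k.1 + k.2) * c k) (fun n => ?_) (orthonormal_sign_smul h)
  convert (hc n).const_smul ((-1 : ℂ) ^ (n.1 + n.2)) using 1
  ext1 k
  -- The sign on `c k` cancels the `k`-part of the twist of `φ_{k+n}`, leaving only the sign of `n`.
  have hk : (-1 : ℂ) ^ (k.1 + k.2) * (-1 : ℂ) ^ (k.1 + k.2) = 1 := by
    rw [← mul_zpow, neg_one_mul, neg_neg, one_zpow]
  rw [twistedCoherent, smul_smul, smul_smul, Prod.fst_add, Prod.snd_add, add_add_add_comm,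
    zpow_add₀ (neg_ne_zero.mpr one_ne_zero) (k.1 + k.2)]
  congr 1
  rw [mul_right_comm, ← mul_assoc, hk, one_mul, mul_comm]

/-- The adjoint of the lattice operator at `k` is the one at `-k`, so reindexing by `k ↦ -k` matches
the condition on `c`. -/
theorem IsOperatorSeries.isSymmetric {a : ℝ} (ha : a ^ 2 = 2 * Real.pi) {c : ℤ × ℤ → ℂ}
    {X : StateSpace →L[ℂ] StateSpace} (hX : IsOperatorSeries a c X)
    (hc : ∀ k, c (-k) = star (c k)) : X.toLinearMap.IsSymmetric := by
  intro f g
  have h1 := ((Equiv.neg (ℤ × ℤ)).hasSum_iff.mpr (hX f)).mapL ((innerSL ℂ) g)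
  have h2 := (hX g).mapL (innerSL ℂ f)
  have h3 : HasSum (fun k => inner ℂ f (c k • latticeOp a k g)) (inner ℂ (X f) g) := by
    have h4 := Complex.hasSum_conj'.mpr h1
    simp only [innerSL_apply_apply, inner_conj_symm] at h4
    convert h4 using 1
    ext1 k
    rw [Function.comp_apply, Equiv.neg_apply, hc, inner_smul_right, inner_smul_left,
      inner_latticeOp_right ha, starRingEnd_apply, star_star]
  exact h3.unique h2

/-- This is the expansion of `f` in a Hilbert basis. -/
theorem IsFrameOperator.eq_one {Ψ : ℤ × ℤ → StateSpace} {S : StateSpace →L[ℂ] StateSpace}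
    (hS : IsFrameOperator Ψ S) (hΨ : Orthonormal ℂ Ψ) (hc : CompleteFamily Ψ) : S = 1 := by
  ext1 f
  have h := (HilbertBasis.mk hΨ (le_of_eq hc.symm)).hasSum_repr f
  simp only [HilbertBasis.repr_apply_apply, HilbertBasis.coe_mk] at h
  exact (hS f).unique h

/-- A symmetric involution preserves inner products. -/
theorem orthonormal_of_sq_eq_one {φ : ℤ × ℤ → StateSpace} {X : StateSpace →L[ℂ] StateSpace}
    (hX : X.toLinearMap.IsSymmetric) (hsq : X ^ 2 = 1) (h : Orthonormal ℂ fun n => X (φ n)) :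
    Orthonormal ℂ φ := by
  have hinner : ∀ m n, inner ℂ (X (φ m)) (X (φ n)) = inner ℂ (φ m) (φ n) := by
    intro m n
    have h1 : X (X (φ n)) = φ n := by
      have h2 := congrArg (fun U : StateSpace →L[ℂ] StateSpace => U (φ n)) hsq
      rwa [sq] at h2
    exact (hX _ _).trans (congrArg _ h1)
  rw [orthonormal_iff_ite] at h ⊢
  intro m n
  rw [← hinner, h]

end Coherent

open Coherent
theorem mainTheorem4 (a : ℝ) (ha : a ^ 2 = 2 * Real.pi) :
    ¬ Orthonormal ℂ (coherent a) ∧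
    (∀ (c : ℤ × ℤ → ℂ) (Ψ : ℤ × ℤ → StateSpace), IsExpansion a c Ψ →
      ¬ (Orthonormal ℂ Ψ ∧ CompleteFamily Ψ)) ∧
    (∀ X : StateSpace →L[ℂ] StateSpace,
      ¬ (Orthonormal ℂ (fun n => X (coherent a n)) ∧
        CompleteFamily (fun n => X (coherent a n)))) ∧
    (∀ (c : ℤ × ℤ → ℂ) (X S : StateSpace →L[ℂ] StateSpace) (Ψ : ℤ × ℤ → StateSpace),
      (∀ k, c (-k) = star (c k)) → IsOperatorSeries a c X →
      (∀ n, Ψ n = X (coherent a n)) → Orthonormal ℂ Ψ → IsFrameOperator Ψ S →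
      S = X ^ 2 ∧
      (CompleteFamily Ψ → S = 1) ∧
      (S = 1 → Orthonormal ℂ (coherent a))) := by
  refine ⟨not_orthonormal_coherent ha, fun c Ψ hc h => not_orthonormal_of_isExpansion ha hc h.1,
    fun X h => not_orthonormal_map_coherent ha X h.1, fun c X S Ψ hc hX hΨX hΨ hS => ?_⟩
  obtain rfl : Ψ = fun n => X (coherent a n) := funext hΨX
  -- Orthonormality alone is already impossible, which is the only reason for `S = X ^ 2`.
  have hsq : S = X ^ 2 := absurd hΨ (not_orthonormal_map_coherent ha X)
  exact ⟨hsq, hS.eq_one hΨ, fun h1 => orthonormal_of_sq_eq_one (hX.isSymmetric ha hc)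
    (hsq.symm.trans h1) hΨ⟩
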